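/- Let $u\ge 1$, $m=2u$, $n=2^m-1$, $r=2^u+1$, and let $\alpha$ be a primitive element of $\mathbb F_{2^m}$. Fix an $\mathbb F_2$-linear identification of $\mathbb F_{2^m}$ with $\mathbb F_2^m$ (binary representation). Let $H_m$ and $E_m$ be the binary matrices whose columns are the binary representations of $\alpha^0,\alpha^1,\dots,\alpha^{n-1}$ and of $\alpha^{0},\alpha^{r},\dots,\alpha^{(n-1)r}$, respectively, and let $C^{(u)}\subseteq\mathbb F_2^n$ be the binary linear code whose parity check matrix is the vertical join of $H_m$ and $E_m$. Write $\alpha^j=\gamma_{j1}+\gamma_{j2}\alpha$ with $\gamma_{j1},\gamma_{j2}\in\mathbb F_{2^u}$, and for $\mathbf v\in\mathbb F_2^n$ put $S(\mathbf v)=\sum_{j\in \mathrm{Supp}(\mathbf v)}\gamma_{j1}\gamma_{j2}\in\mathbb F_{2^u}$. Let $0\le i\le u$, let $\mathbf v_1,\dots,\mathbf v_{u-i}\in\mathbb F_2^n$ be such that each coset $C^{(u)}+\mathbf v_l$ has minimum weight $3$ and such that $S(\mathbf v_1),\dots,S(\mathbf v_{u-i})$ are linearly independent over $\mathbb F_2$,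 and let $C^{(i)}=\langle C^{(u)},\mathbf v_1,\dots,\mathbf v_{u-i}\rangle$. Let $C^{(i)*}\subseteq\mathbb F_2^{n+1}$ be the extended code, obtained from $C^{(i)}$ by adding an overall parity check as a $0$-th coordinate. Attach to the coordinates of $C^{(i)*}$ the vectors of $\mathbb F_2^m$: the zero vector to the parity coordinate, and the corresponding column of $H_m$ to every other coordinate. For a binary linear code $C$, $\mathrm{Aut}(C)$ denotes the group of all coordinate permutations that send $C$ into itself; it acts on the cosets of $C$ by $\pi(C+\mathbf v)=C+\pi(\mathbf v)$. A code $C$ with covering radius $\rho$ is called completely transitive if $\mathrm{Aut}(C)$ has exactly $\rho+1$ orbits on the cosets of $C$. Then: 1. $\mathrm{Aut}(C^{(i)*})=\mathrm{Aut}(C^{(i)})\ltimes\mathbb F_2^m$, where $\mathbf w\in\mathbb F_2^m$ acts as the translation that sends the coordinate with attached vector $\mathbf x$ to the coordinate with attached vector $\mathbf w+\mathbf x$ (these translations form the normal subgroup), and $\mathrm{Aut}(C^{(i)})$ acts on the $n$ original coordinates and fixes the parity coordinate. 2. If $C^{(i)}$ is completely transitive, then $C^{(i)*}$ is completely transitive.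 -/

import Mathlib

noncomputable section

namespace NestedCodes

/-! ### Binary linear codes, automorphisms, complete transitivity -/

section Codes

variable {ι : Type*} [Fintype ι]

/-- Coordinate permutation of binary vectors: the entry in position `j` is moved to
position `σ j`. -/
def permVec {ι : Type*} (σ : Equiv.Perm ι) : (ι → ZMod 2) →ₗ[ZMod 2] (ι → ZMod 2) :=
  LinearMap.funLeft (ZMod 2) (ZMod 2) (σ⁻¹ : Equiv.Perm ι)

theorem permVec_apply {ι : Type*} (σ : Equiv.Perm ι) (c : ι → ZMod 2) (j : ι) :
    permVec σ c j = c (σ⁻¹ j) := rfl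

theorem permVec_one {ι : Type*} (c : ι → ZMod 2) : permVec 1 c = c := rfl

theorem permVec_mul {ι : Type*} (σ τ : Equiv.Perm ι) (c : ι → ZMod 2) :
    permVec (σ * τ) c = permVec σ (permVec τ c) := by
  funext j
  simp [permVec_apply, mul_inv_rev]

/-- The automorphism group of a binary linear code: all coordinate permutations which
send the code into itself. -/
def autGroup (C : Submodule (ZMod 2) (ι → ZMod 2)) : Subgroup (Equiv.Perm ι) where
  carrier := {σ | ∀ c ∈ C, permVec σ c ∈ C}
  one_mem' := fun c hc => by rwa [permVec_one]
  mul_mem' := fun {σ τ} hσ hτ c hc => by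
    rw [permVec_mul]
    exact hσ _ (hτ _ hc)
  inv_mem' := fun {σ} hσ c hc => by
    have hpow : ∀ k : ℕ, permVec (σ ^ k) c ∈ C := by
      intro k
      induction k with
      | zero => simpa [permVec_one] using hc
      | succ k ih =>
        rw [pow_succ', permVec_mul]
        exact hσ _ ih
    have hfin : IsOfFinOrder σ := by
      classical exact isOfFinOrder_of_finite σ
    have hinv : σ⁻¹ = σ ^ (orderOf σ - 1) := by
      rw [inv_eq_iff_mul_eq_one, ← pow_succ', Nat.sub_add_cancel hfin.orderOf_pos]
      exact pow_orderOf_eq_one σ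
    rw [hinv]
    exact hpow _

/-- The natural action of the automorphism group on the cosets of the code:
`σ (C + v) = C + σ v`. -/
instance cosetAction (C : Submodule (ZMod 2) (ι → ZMod 2)) :
    MulAction (autGroup C) ((ι → ZMod 2) ⧸ C) where
  smul σ B := Submodule.mapQ C C (permVec (σ : Equiv.Perm ι)) (fun c hc => σ.2 c hc) B
  one_smul B := by
    obtain ⟨v, rfl⟩ := Submodule.Quotient.mk_surjective C B
    rfl
  mul_smul σ τ B := by
    obtain ⟨v, rfl⟩ := Submodule.Quotient.mk_surjective C B
    rfl

theorem smul_coset_mk (C : Submodule (ZMod 2) (ι → ZMod 2)) (σ : autGroup C)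
    (v : ι → ZMod 2) :
    σ • (Submodule.Quotient.mk v : (ι → ZMod 2) ⧸ C) =
      Submodule.Quotient.mk (permVec (σ : Equiv.Perm ι) v) := rfl

/-- The Hamming distance from the vector `v` to the code `C`. -/
def codeDist (C : Submodule (ZMod 2) (ι → ZMod 2)) (v : ι → ZMod 2) : ℕ :=
  sInf {d | ∃ c ∈ C, hammingDist v c = d}

/-- The covering radius: the maximal distance of a vector to the code. -/
def coveringRadius (C : Submodule (ZMod 2) (ι → ZMod 2)) : ℕ :=
  ⨆ v : ι → ZMod 2, codeDist C v

/-- The weight of the coset `C + v`: the minimum Hamming weight of its elements. -/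
def cosetWeight (C : Submodule (ZMod 2) (ι → ZMod 2)) (v : ι → ZMod 2) : ℕ :=
  sInf {w | ∃ c ∈ C, hammingNorm (c + v) = w}

/-- A code with covering radius `ρ` is completely transitive if its automorphism group has
exactly `ρ + 1` orbits on the set of cosets of the code. -/
def CompletelyTransitive (C : Submodule (ZMod 2) (ι → ZMod 2)) : Prop :=
  Nat.card (MulAction.orbitRel.Quotient (autGroup C) ((ι → ZMod 2) ⧸ C)) =
    coveringRadius C + 1

end Codes

/-- The extended code: an overall parity check is added as coordinate `0`. -/
def extendedCode {n : ℕ} (C : Submodule (ZMod 2) (Fin n → ZMod 2)) :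
    Submodule (ZMod 2) (Fin (n + 1) → ZMod 2) where
  carrier := {x | (fun j : Fin n => x j.succ) ∈ C ∧ ∑ j, x j = 0}
  zero_mem' := ⟨C.zero_mem, by simp⟩
  add_mem' := fun {x y} hx hy =>
    ⟨C.add_mem hx.1 hy.1, by simp [Finset.sum_add_distrib, hx.2, hy.2]⟩
  smul_mem' := fun a x hx =>
    ⟨C.smul_mem a hx.1, by
      have h := hx.2
      simp [← Finset.mul_sum, h]⟩

/-! ### The quadratic extension -/

section Field

variable {F : Type*} [Field F]

/-- `p = (γ₁, γ₂)` is the pair of elements of the subfield `𝔽_{2^u} = {y | y ^ 2 ^ u = y}`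
with `x = γ₁ + γ₂ α`. -/
def IsCoords (u : ℕ) (α x : F) (p : F × F) : Prop :=
  p.1 ^ 2 ^ u = p.1 ∧ p.2 ^ 2 ^ u = p.2 ∧ x = p.1 + p.2 * α

/-- The coordinates `(γ₁, γ₂)` of `x = γ₁ + γ₂ α`; see `coords_spec` and `coords_eq`. -/
def coords (u : ℕ) (α x : F) : F × F :=
  Classical.epsilon (IsCoords u α x)

theorem existsUnique_isCoords [Fintype F] [Algebra (ZMod 2) F] {u : ℕ} (hu : 1 ≤ u)
    (hF : Fintype.card F = 2 ^ (2 * u)) {α : F} (hα : IsPrimitiveRoot α (2 ^ (2 * u) - 1))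
    (x : F) : ∃! p : F × F, IsCoords u α x p := by
  have hch : CharP F 2 := charP_of_injective_algebraMap (algebraMap (ZMod 2) F).injective 2
  have hq2 : ∀ y : F, (y ^ 2 ^ u) ^ 2 ^ u = y := by
    intro y
    rw [← pow_mul, ← pow_add, ← two_mul, ← hF]
    exact FiniteField.pow_card y
  have hadd : ∀ y z : F, (y + z) ^ 2 ^ u = y ^ 2 ^ u + z ^ 2 ^ u := fun y z =>
    add_pow_char_pow (p := 2) (n := u) y z
  have hself : ∀ y : F, y + y = 0 := fun y => CharTwo.add_self_eq_zero y
  have h2 : 2 ≤ 2 ^ u := by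
    calc 2 = 2 ^ 1 := rfl
      _ ≤ 2 ^ u := Nat.pow_le_pow_right (by norm_num) hu
  have hsq : 2 ^ (2 * u) = 2 ^ u * 2 ^ u := by rw [two_mul, pow_add]
  have hlt : 2 ^ u < 2 ^ (2 * u) := by rw [hsq]; nlinarith
  have hα0 : α ≠ 0 := hα.ne_zero (by omega)
  have hne : α ^ 2 ^ u + α ≠ 0 := by
    intro h
    have h1 : α ^ 2 ^ u = α := CharTwo.add_eq_zero.mp h
    have h3 : α ^ (2 ^ u - 1) = 1 := by
      have h4 : α * α ^ (2 ^ u - 1) = α * 1 := by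
        rw [← pow_succ', Nat.sub_add_cancel (by omega), h1, mul_one]
      exact mul_left_cancel₀ hα0 h4
    exact hα.pow_ne_one_of_pos_of_lt (by omega) (by omega) h3
  have hfix : ((x ^ 2 ^ u + x) / (α ^ 2 ^ u + α)) ^ 2 ^ u =
      (x ^ 2 ^ u + x) / (α ^ 2 ^ u + α) := by
    rw [div_pow, hadd, hadd, hq2, hq2, add_comm x, add_comm α]
  refine ⟨(x + (x ^ 2 ^ u + x) / (α ^ 2 ^ u + α) * α,
    (x ^ 2 ^ u + x) / (α ^ 2 ^ u + α)), ⟨?_, hfix, ?_⟩, ?_⟩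
  · simp only [hadd, mul_pow, hfix]
    have h5 : (x ^ 2 ^ u + x) / (α ^ 2 ^ u + α) * (α ^ 2 ^ u + α) = x ^ 2 ^ u + x :=
      div_mul_cancel₀ _ hne
    rw [← CharTwo.add_eq_zero]
    linear_combination h5 + hself (x ^ 2 ^ u) + hself x
  · simp [add_assoc, hself]
  · rintro ⟨a, b⟩ ⟨ha, hb, hx⟩
    simp only at ha hb hx
    have h6 : x ^ 2 ^ u + x = b * (α ^ 2 ^ u + α) := by
      rw [hx, hadd, mul_pow, ha, hb]
      linear_combination hself a
    have h7 : (x ^ 2 ^ u + x) / (α ^ 2 ^ u + α) = b := by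
      rw [h6, mul_div_cancel_right₀ _ hne]
    rw [h7, hx, add_assoc, hself, add_zero]

theorem coords_spec [Fintype F] [Algebra (ZMod 2) F] {u : ℕ} (hu : 1 ≤ u)
    (hF : Fintype.card F = 2 ^ (2 * u)) {α : F} (hα : IsPrimitiveRoot α (2 ^ (2 * u) - 1))
    (x : F) : IsCoords u α x (coords u α x) :=
  Classical.epsilon_spec (existsUnique_isCoords hu hF hα x).exists

theorem coords_eq [Fintype F] [Algebra (ZMod 2) F] {u : ℕ} (hu : 1 ≤ u)
    (hF : Fintype.card F = 2 ^ (2 * u)) {α : F} (hα : IsPrimitiveRoot α (2 ^ (2 * u) - 1))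
    {x : F} {p : F × F} (hp : IsCoords u α x p) : coords u α x = p :=
  (existsUnique_isCoords hu hF hα x).unique (coords_spec hu hF hα x) hp

/-- `S(v)`: the sum of `γ₁ γ₂` over the columns `α^j = γ₁ + γ₂ α`, `j` in the support
of `v`. -/
def synS (u : ℕ) (α : F) (v : Fin (2 ^ (2 * u) - 1) → ZMod 2) : F :=
  ∑ j with v j ≠ 0, (coords u α (α ^ (j : ℕ))).1 * (coords u α (α ^ (j : ℕ))).2

/-! ### The nested codes

`rep` is the binary representation of the elements of `F = 𝔽_{2^{2u}}` by vectors of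
length `m = 2u`. -/

variable [Algebra (ZMod 2) F]

/-- The matrix `H_m`: its columns are the binary representations of
`α^0, α^1, …, α^(n-1)`, where `n = 2^m - 1`. -/
def matrixH {u : ℕ} (rep : F ≃ₗ[ZMod 2] (Fin (2 * u) → ZMod 2)) (α : F) :
    Matrix (Fin (2 * u)) (Fin (2 ^ (2 * u) - 1)) (ZMod 2) :=
  Matrix.of fun k j => rep (α ^ (j : ℕ)) k

/-- The matrix `E_m`: its columns are the binary representations of
`α^(0 r), α^r, …, α^((n-1) r)`, where `r = 2^u + 1`. -/
def matrixE {u : ℕ} (rep : F ≃ₗ[ZMod 2] (Fin (2 * u) → ZMod 2)) (α : F) :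
    Matrix (Fin (2 * u)) (Fin (2 ^ (2 * u) - 1)) (ZMod 2) :=
  Matrix.of fun k j => rep (α ^ ((j : ℕ) * (2 ^ u + 1))) k

/-- The code `C^(u)`, whose parity check matrix is the vertical join of `H_m` and `E_m`. -/
def codeU {u : ℕ} (rep : F ≃ₗ[ZMod 2] (Fin (2 * u) → ZMod 2)) (α : F) :
    Submodule (ZMod 2) (Fin (2 ^ (2 * u) - 1) → ZMod 2) :=
  LinearMap.ker (Matrix.mulVecLin (Matrix.fromRows (matrixH rep α) (matrixE rep α)))

/-- Admissible choices of `v_1, …, v_k` in the construction of the nested codes: they represent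
cosets of `C^(u)` of weight three, and `S(v_1), …, S(v_k)` are linearly independent
over `𝔽_2`. -/
def Admissible {u : ℕ} (rep : F ≃ₗ[ZMod 2] (Fin (2 * u) → ZMod 2)) (α : F) {k : ℕ}
    (v : Fin k → Fin (2 ^ (2 * u) - 1) → ZMod 2) : Prop :=
  (∀ l, cosetWeight (codeU rep α) (v l) = 3) ∧
    LinearIndependent (ZMod 2) (fun l => synS u α (v l))

/-- The code generated by `C^(u)` and `v_1, …, v_k`; it is called `C^(i)` when `k = u - i`. -/
def nestedCode {u : ℕ} (rep : F ≃ₗ[ZMod 2] (Fin (2 * u) → ZMod 2)) (α : F) {k : ℕ}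
    (v : Fin k → Fin (2 ^ (2 * u) - 1) → ZMod 2) :
    Submodule (ZMod 2) (Fin (2 ^ (2 * u) - 1) → ZMod 2) :=
  codeU rep α ⊔ Submodule.span (ZMod 2) (Set.range v)

/-- The vector of `𝔽_2^m` attached to a coordinate of the extended codes: the zero vector for
the parity coordinate `0`, and the column of `H_m` for every other coordinate. -/
def coordVec {u : ℕ} (rep : F ≃ₗ[ZMod 2] (Fin (2 * u) → ZMod 2)) (α : F) :
    Fin (2 ^ (2 * u) - 1 + 1) → Fin (2 * u) → ZMod 2 :=
  Fin.cons 0 (fun j k => matrixH rep α k j)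

end Field

end NestedCodes

end

noncomputable section

namespace NestedCodes

/-! ### Complete transitivity -/

section Codes

variable {ι : Type*} [Fintype ι]

/-! Put q = 2^u and N(y) = y^(q+1), the norm to the subfield of order q. The extended coordinates
are labelled by the elements of F, the parity coordinate by 0. An even-weight word lies in the
extended C^(u) exactly when its labels, and the norms of its labels, sum to zero.

A word of weight at most two realises any pair of sums (h, e) with h ≠ 0 and e in the subfield
(`exists_norm_add_norm`). Hence cosets of weight three lie in the Hamming code, and C = C^(i) is
sandwiched between C^(u) and the Hamming code. The rest of the argument uses only this sandwich.

Translations: N(s + y) - N(y) is a constant plus s^q y + s y^q, so translating a word of the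
extended Hamming code changes it by a word of the extended C^(u); translations therefore preserve
the extended code of C. Conversely, every automorphism of that code preserves the extended Hamming
code, so it is affine on F and normalises the translations. The stabiliser of the parity coordinate
is Aut(C), which gives the semidirect product.

Complete transitivity: translations allow a minimum-weight coset representative to be chosen nonzero
at the parity coordinate. Puncturing then lowers the distance by exactly one, and an automorphism of
C matching the punctured vectors extends. -/

theorem permVec_apply_apply {ι : Type*} (σ : Equiv.Perm ι) (c : ι → ZMod 2) (j : ι) :
    permVec σ c (σ j) = c j := by
  simp [permVec_apply]

theorem hammingNorm_permVec (σ : Equiv.Perm ι) (c : ι → ZMod 2) :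
    hammingNorm (permVec σ c) = hammingNorm c := by
  classical
  unfold hammingNorm
  refine (Finset.card_bij (fun j _ => σ j) ?_ ?_ ?_).symm
  · intro j hj
    simpa [permVec_apply_apply] using hj
  · intro a _ b _ h
    exact σ.injective h
  · intro b hb
    refine ⟨σ⁻¹ b, ?_, by simp⟩
    rw [Finset.mem_filter] at hb ⊢
    exact ⟨Finset.mem_univ _, hb.2⟩

theorem hammingDist_eq_hammingNorm_sub (v c : ι → ZMod 2) :
    hammingDist v c = hammingNorm (v - c) := by
  rw [hammingDist_comm, hammingDist_eq_hammingNorm, neg_add_eq_sub]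

theorem codeDist_le (C : Submodule (ZMod 2) (ι → ZMod 2)) {v c : ι → ZMod 2} (h : v - c ∈ C) :
    codeDist C v ≤ hammingNorm c := by
  refine Nat.sInf_le ⟨v - c, h, ?_⟩
  rw [hammingDist_eq_hammingNorm_sub, sub_sub_cancel]

theorem exists_hammingNorm_eq_codeDist (C : Submodule (ZMod 2) (ι → ZMod 2)) (v : ι → ZMod 2) :
    ∃ c, v - c ∈ C ∧ hammingNorm c = codeDist C v := by
  have hne : {d | ∃ c ∈ C, hammingDist v c = d}.Nonempty := ⟨_, 0, C.zero_mem, rfl⟩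
  obtain ⟨c, hc, h⟩ := Nat.sInf_mem hne
  refine ⟨v - c, by simpa using hc, ?_⟩
  rw [← hammingDist_eq_hammingNorm_sub]
  exact h

theorem codeDist_congr (C : Submodule (ZMod 2) (ι → ZMod 2)) {v w : ι → ZMod 2}
    (h : v - w ∈ C) : codeDist C v = codeDist C w := by
  have key : ∀ {v w : ι → ZMod 2}, v - w ∈ C → codeDist C v ≤ codeDist C w := by
    intro v w h
    obtain ⟨c, hc, hcw⟩ := exists_hammingNorm_eq_codeDist C w
    rw [← hcw]
    exact codeDist_le C (by simpa using C.add_mem h hc)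
  exact le_antisymm (key h) (key (by simpa using C.neg_mem h))

theorem codeDist_permVec (C : Submodule (ZMod 2) (ι → ZMod 2)) {σ : Equiv.Perm ι}
    (hσ : σ ∈ autGroup C) (v : ι → ZMod 2) : codeDist C (permVec σ v) = codeDist C v := by
  have key : ∀ {σ : Equiv.Perm ι}, σ ∈ autGroup C → ∀ v,
      codeDist C (permVec σ v) ≤ codeDist C v := by
    intro σ hσ v
    obtain ⟨c, hc, hcv⟩ := exists_hammingNorm_eq_codeDist C v
    rw [← hcv, ← hammingNorm_permVec σ c]
    refine codeDist_le C ?_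
    rw [← map_sub]
    exact hσ _ hc
  refine le_antisymm (key hσ v) ?_
  have h := key (inv_mem hσ) (permVec σ v)
  rwa [← permVec_mul, inv_mul_cancel, permVec_one] at h

theorem codeDist_le_coveringRadius (C : Submodule (ZMod 2) (ι → ZMod 2)) (v : ι → ZMod 2) :
    codeDist C v ≤ coveringRadius C :=
  le_ciSup (Set.finite_range (codeDist C)).bddAbove v

/-- Deleting one nonzero entry from a minimum-weight coset representative lowers the distance by
exactly one, so one can descend from the covering radius. -/
theorem exists_codeDist_eq (C : Submodule (ZMod 2) (ι → ZMod 2)) {d : ℕ}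
    (hd : d ≤ coveringRadius C) : ∃ v, codeDist C v = d := by
  classical
  refine Nat.decreasingInduction' (P := fun d => ∃ v, codeDist C v = d) ?_ hd
    (exists_eq_ciSup_of_finite (f := codeDist C))
  rintro k - - ⟨v, hv⟩
  obtain ⟨z, hz, hzv⟩ := exists_hammingNorm_eq_codeDist C v
  have hz0 : z ≠ 0 := by
    rintro rfl
    rw [hv, hammingNorm_zero] at hzv
    omega
  obtain ⟨j, hj⟩ := Function.ne_iff.mp hz0
  have hupd : ∀ y : ι → ZMod 2, hammingNorm (y + Pi.single j (z j)) ≤ hammingNorm y + 1 := by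
    intro y
    calc hammingNorm (y + Pi.single j (z j))
        ≤ (insert j (Finset.univ.filter fun k => y k ≠ 0)).card := by
          refine Finset.card_le_card fun k hk => ?_
          by_cases hkj : k = j <;> simp_all
      _ ≤ _ := Finset.card_insert_le _ _
  have hnorm : hammingNorm (z - Pi.single j (z j)) + 1 = hammingNorm z := by
    have hset : (Finset.univ.filter fun k => (z - Pi.single j (z j) : ι → ZMod 2) k ≠ 0) =
        (Finset.univ.filter fun k => z k ≠ 0).erase j := by
      ext k
      by_cases hkj : k = j
      · subst hkj; simp
      · simp [hkj]
    unfold hammingNorm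
    rw [hset]
    exact Finset.card_erase_add_one (by simpa using hj)
  refine ⟨z - Pi.single j (z j), le_antisymm ?_ ?_⟩
  · refine (codeDist_le C (c := z - Pi.single j (z j)) (by simp)).trans ?_
    omega
  · obtain ⟨y, hy, hyz⟩ := exists_hammingNorm_eq_codeDist C (z - Pi.single j (z j))
    have h1 : codeDist C v ≤ hammingNorm (y + Pi.single j (z j)) := by
      refine codeDist_le C ?_
      have h2 := C.add_mem hz hy
      convert h2 using 1
      abel
    have h3 := hupd y
    omega

/-- A code is completely transitive if and only if vectors at equal distance from the code lie in
cosets which are conjugate under its automorphism group. -/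
theorem completelyTransitive_iff (C : Submodule (ZMod 2) (ι → ZMod 2)) :
    CompletelyTransitive C ↔ ∀ v w, codeDist C v = codeDist C w →
      ∃ σ ∈ autGroup C, permVec σ v - w ∈ C := by
  let g : (ι → ZMod 2) ⧸ C → ℕ :=
    Quotient.lift (codeDist C) fun v w h => codeDist_congr C (Submodule.quotientRel_def C |>.mp h)
  have hg : ∀ v, g (Submodule.Quotient.mk v) = codeDist C v := fun _ => rfl
  -- Distance is constant on orbits and takes all `ρ + 1` values, so the orbit count is `ρ + 1`
  -- exactly when this surjection is injective.
  let f : MulAction.orbitRel.Quotient (autGroup C) ((ι → ZMod 2) ⧸ C) →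
      Fin (coveringRadius C + 1) :=
    Quotient.lift (fun B => ⟨g B, by
      obtain ⟨v, rfl⟩ := Submodule.Quotient.mk_surjective C B
      rw [hg]
      exact Nat.lt_succ_of_le (codeDist_le_coveringRadius C v)⟩) (by
      rintro A B ⟨σ, rfl⟩
      obtain ⟨v, rfl⟩ := Submodule.Quotient.mk_surjective C B
      simp only [smul_coset_mk, hg, codeDist_permVec C σ.2])
  have hf : ∀ v, (f (Quotient.mk _ (Submodule.Quotient.mk v)) : ℕ) = codeDist C v := fun _ => rfl
  have hsurj : Function.Surjective f := by
    intro d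
    obtain ⟨v, hv⟩ := exists_codeDist_eq C (Nat.le_of_lt_succ d.2)
    exact ⟨(Quotient.mk _ (Submodule.Quotient.mk v)), Fin.ext hv⟩
  have hinj : Function.Injective f ↔ ∀ v w, codeDist C v = codeDist C w →
      ∃ σ ∈ autGroup C, permVec σ v - w ∈ C := by
    constructor
    · intro h v w hvw
      have h1 : f (Quotient.mk _ (Submodule.Quotient.mk w)) = f (Quotient.mk _ (Submodule.Quotient.mk v)) :=
        Fin.ext hvw.symm
      obtain ⟨σ, hσ⟩ := Quotient.exact (h h1)
      refine ⟨σ, σ.2, ?_⟩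
      rw [← Submodule.Quotient.eq, ← smul_coset_mk]
      exact hσ
    · intro h A B hAB
      induction A using Quotient.inductionOn with | _ A => ?_
      induction B using Quotient.inductionOn with | _ B => ?_
      obtain ⟨v, rfl⟩ := Submodule.Quotient.mk_surjective C A
      obtain ⟨w, rfl⟩ := Submodule.Quotient.mk_surjective C B
      obtain ⟨σ, hσ, hσv⟩ := h w v (Fin.ext_iff.mp hAB).symm
      refine Quotient.sound ⟨⟨σ, hσ⟩, ?_⟩
      exact (Submodule.Quotient.eq C).mpr hσv
  have hfin' : Finite ((ι → ZMod 2) ⧸ C) := Quotient.finite _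
  have hfin : Finite (MulAction.orbitRel.Quotient (autGroup C) ((ι → ZMod 2) ⧸ C)) :=
    Quotient.finite _
  rw [← hinj, CompletelyTransitive]
  constructor
  · intro h
    exact (hsurj.bijective_of_nat_card_le (by rw [h, Nat.card_fin])).1
  · intro h
    rw [Nat.card_eq_of_bijective f ⟨h, hsurj⟩, Nat.card_fin]

end Codes

/-! ### Automorphisms of extended codes -/

section Extended

variable {n : ℕ}

/-- The extension of a permutation of the original coordinates which fixes the parity
coordinate. -/
def extendPerm : Equiv.Perm (Fin n) →* Equiv.Perm (Fin (n + 1)) where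
  toFun σ := Equiv.Perm.decomposeFin.symm (0, σ)
  map_one' := by
    ext j
    cases j using Fin.cases <;> simp
  map_mul' σ τ := by
    ext j
    cases j using Fin.cases <;> simp

@[simp]
theorem extendPerm_zero (σ : Equiv.Perm (Fin n)) : extendPerm σ 0 = 0 := by
  simp [extendPerm]

@[simp]
theorem extendPerm_succ (σ : Equiv.Perm (Fin n)) (j : Fin n) :
    extendPerm σ j.succ = (σ j).succ := by
  simp [extendPerm]

theorem exists_extendPerm_eq {π : Equiv.Perm (Fin (n + 1))} (h : π 0 = 0) :
    ∃ σ, extendPerm σ = π := by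
  obtain ⟨⟨p, σ⟩, rfl⟩ := Equiv.Perm.decomposeFin.symm.surjective π
  rw [Equiv.Perm.decomposeFin_symm_apply_zero] at h
  exact ⟨σ, by rw [h]; rfl⟩

theorem permVec_extendPerm_succ (σ : Equiv.Perm (Fin n)) (x : Fin (n + 1) → ZMod 2) :
    (fun j : Fin n => permVec (extendPerm σ) x j.succ) = permVec σ fun j => x j.succ := by
  funext j
  rw [permVec_apply, permVec_apply, ← map_inv, extendPerm_succ]

theorem sum_permVec {ι : Type*} [Fintype ι] (σ : Equiv.Perm ι) (x : ι → ZMod 2) :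
    ∑ j, permVec σ x j = ∑ j, x j :=
  Equiv.sum_comp σ⁻¹ x

theorem mem_extendedCode {C : Submodule (ZMod 2) (Fin n → ZMod 2)} {x : Fin (n + 1) → ZMod 2} :
    x ∈ extendedCode C ↔ (fun j : Fin n => x j.succ) ∈ C ∧ ∑ j, x j = 0 :=
  Iff.rfl

/-- The extension of a vector by an overall parity check. -/
def extendVec (c : Fin n → ZMod 2) : Fin (n + 1) → ZMod 2 :=
  Fin.cons (∑ j, c j) c

theorem extendVec_mem {C : Submodule (ZMod 2) (Fin n → ZMod 2)} {c : Fin n → ZMod 2}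
    (hc : c ∈ C) : extendVec c ∈ extendedCode C := by
  refine ⟨hc, ?_⟩
  simp [Fin.sum_univ_succ, extendVec, CharTwo.add_self_eq_zero]

theorem extendPerm_mem_autGroup {C : Submodule (ZMod 2) (Fin n → ZMod 2)}
    {σ : Equiv.Perm (Fin n)} :
    extendPerm σ ∈ autGroup (extendedCode C) ↔ σ ∈ autGroup C := by
  constructor
  · intro h c hc
    have h1 := (h _ (extendVec_mem hc)).1
    rwa [permVec_extendPerm_succ] at h1
  · intro h x hx
    refine ⟨?_, by rw [sum_permVec]; exact hx.2⟩
    rw [permVec_extendPerm_succ]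
    exact h _ hx.1

/-- The embedding of the automorphism group of a code into that of the extended code. -/
def extendAut (C : Submodule (ZMod 2) (Fin n → ZMod 2)) :
    autGroup C →* autGroup (extendedCode C) :=
  (extendPerm.comp (autGroup C).subtype).codRestrict _ fun σ => extendPerm_mem_autGroup.mpr σ.2

theorem coe_extendAut (C : Submodule (ZMod 2) (Fin n → ZMod 2)) (σ : autGroup C) :
    (extendAut C σ : Equiv.Perm (Fin (n + 1))) = extendPerm (σ : Equiv.Perm (Fin n)) := rfl

theorem sum_eq_hammingNorm {ι : Type*} [Fintype ι] (x : ι → ZMod 2) :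
    ∑ j, x j = (hammingNorm x : ZMod 2) := by
  classical
  have h : ∀ a : ZMod 2, a = if a ≠ 0 then 1 else 0 := by decide
  rw [hammingNorm, Finset.sum_congr rfl fun j _ => h (x j), Finset.sum_boole]

theorem hammingNorm_succ (x : Fin (n + 1) → ZMod 2) :
    hammingNorm x = (if x 0 ≠ 0 then 1 else 0) + hammingNorm fun j : Fin n => x j.succ := by
  simp only [hammingNorm, Finset.card_filter, Fin.sum_univ_succ]

/-- If `x` has minimum weight in its coset of the extended code and does not vanish at the parity
coordinate, then puncturing decreases the distance to the code by one. -/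
theorem codeDist_tail (C : Submodule (ZMod 2) (Fin n → ZMod 2)) {x : Fin (n + 1) → ZMod 2}
    (hx0 : x 0 ≠ 0) (hx : hammingNorm x = codeDist (extendedCode C) x) :
    codeDist C (fun j => x j.succ) + 1 = hammingNorm x := by
  have h0 := hammingNorm_succ x
  rw [if_pos hx0] at h0
  have h1 : codeDist C (fun j => x j.succ) ≤ hammingNorm fun j : Fin n => x j.succ :=
    codeDist_le C (by simp)
  obtain ⟨c, hc, hcx⟩ := exists_hammingNorm_eq_codeDist C fun j => x j.succ
  -- This competitor in the coset of `x` punctures to the shortest vector `c`, and its parity entry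
  -- costs at most one.
  have h2 : codeDist (extendedCode C) x ≤ hammingNorm (x - extendVec ((fun j : Fin n => x j.succ) - c)) :=
    codeDist_le _ (by simpa using extendVec_mem hc)
  rw [hammingNorm_succ] at h2
  have h3 : (fun j : Fin n => (x - extendVec ((fun j : Fin n => x j.succ) - c)) j.succ) = c := by
    funext j
    simp [extendVec]
  rw [h3, hcx] at h2
  split_ifs at h2 <;> omega

/-- A completely transitive code whose extended code has a transitive automorphism group has a
completely transitive extended code. -/
theorem completelyTransitive_extendedCode {C : Submodule (ZMod 2) (Fin n → ZMod 2)}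
    (htrans : ∀ k : Fin (n + 1), ∃ π ∈ autGroup (extendedCode C), π k = 0)
    (hC : CompletelyTransitive C) : CompletelyTransitive (extendedCode C) := by
  rw [completelyTransitive_iff] at hC ⊢
  have hnormal : ∀ x, codeDist (extendedCode C) x ≠ 0 → ∃ π ∈ autGroup (extendedCode C), ∃ z,
      permVec π x - z ∈ extendedCode C ∧ z 0 ≠ 0 ∧
        hammingNorm z = codeDist (extendedCode C) x := by
    intro x hx
    obtain ⟨c, hc, hcx⟩ := exists_hammingNorm_eq_codeDist (extendedCode C) x
    have hc0 : c ≠ 0 := by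
      rintro rfl
      exact hx (by rw [← hcx, hammingNorm_zero])
    obtain ⟨k, hk⟩ := Function.ne_iff.mp hc0
    obtain ⟨π, hπ, hπk⟩ := htrans k
    refine ⟨π, hπ, permVec π c, ?_, ?_, by rw [hammingNorm_permVec, hcx]⟩
    · rw [← map_sub]
      exact hπ _ hc
    · rw [← hπk, permVec_apply_apply]
      exact hk
  intro x y hxy
  by_cases hx : codeDist (extendedCode C) x = 0
  · have hmem : ∀ v, codeDist (extendedCode C) v = 0 → v ∈ extendedCode C := by
      intro v hv
      obtain ⟨c, hc, hcv⟩ := exists_hammingNorm_eq_codeDist (extendedCode C) v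
      rw [hv, hammingNorm_eq_zero] at hcv
      simpa [hcv] using hc
    refine ⟨1, one_mem _, ?_⟩
    rw [permVec_one]
    exact sub_mem (hmem x hx) (hmem y (hxy ▸ hx))
  · obtain ⟨π, hπ, z, hz, hz0, hzx⟩ := hnormal x hx
    obtain ⟨τ, hτ, t, ht, ht0, hty⟩ := hnormal y (hxy ▸ hx)
    have hz1 := codeDist_tail C hz0
      (by rw [hzx, ← codeDist_congr _ hz, codeDist_permVec _ hπ])
    have ht1 := codeDist_tail C ht0
      (by rw [hty, ← codeDist_congr _ ht, codeDist_permVec _ hτ])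
    have hzt : hammingNorm z = hammingNorm t := by rw [hzx, hxy, hty]
    obtain ⟨σ, hσ, hσz⟩ := hC (fun j => z j.succ) (fun j => t j.succ) (by omega)
    have hext : extendPerm σ ∈ autGroup (extendedCode C) := extendPerm_mem_autGroup.mpr hσ
    -- The punctured parts agree modulo `C` by the choice of `σ`; the overall parity vanishes
    -- because `z` and `t` have equal weight.
    have hmid : permVec (extendPerm σ) z - t ∈ extendedCode C := by
      refine ⟨?_, ?_⟩
      · have h := permVec_extendPerm_succ σ z
        rw [← h] at hσz
        exact hσz
      · simp only [Pi.sub_apply, Finset.sum_sub_distrib, sum_permVec]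
        rw [sum_eq_hammingNorm, sum_eq_hammingNorm, hzt, sub_self]
    refine ⟨τ⁻¹ * extendPerm σ * π, mul_mem (mul_mem (inv_mem hτ) hext) hπ, ?_⟩
    have h1 : permVec τ⁻¹ (permVec (extendPerm σ) (permVec π x - z) +
        (permVec (extendPerm σ) z - t) - (permVec τ y - t)) ∈ extendedCode C :=
      inv_mem hτ _ (sub_mem (add_mem (hext _ hz) hmid) ht)
    convert h1 using 1
    have h2 : permVec τ⁻¹ (permVec τ y) = y := by
      rw [← permVec_mul, inv_mul_cancel, permVec_one]
    simp only [permVec_mul, map_sub, map_add, h2]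
    abel

end Extended

/-! ### Internal semidirect products -/

/-- The action `φ` is conjugation by `g b` on the normal subgroup `f.range`, transported to `N`
along `f`. -/
theorem exists_semidirectProduct_mulEquiv {N K G : Type*} [Group N] [Group K] [Group G]
    (f : N →* G) (g : K →* G) (hf : Function.Injective f) (hg : Function.Injective g)
    (hnormal : f.range.Normal) (hdisj : ∀ a b, f a = g b → f a = 1)
    (hsurj : ∀ x, ∃ a b, f a * g b = x) :
    ∃ (φ : K →* MulAut N) (e : N ⋊[φ] K ≃* G),
      (∀ a, e (SemidirectProduct.inl a) = f a) ∧ ∀ b, e (SemidirectProduct.inr b) = g b := by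
  let φ : K →* MulAut N :=
    (MulAut.congr (MonoidHom.ofInjective hf).symm).toMonoidHom.comp
      ((MulAut.conjNormal (H := f.range)).comp g)
  have hφ : ∀ b a, f (φ b a) = g b * f a * (g b)⁻¹ := by
    intro b a
    have h1 : φ b a = (MonoidHom.ofInjective hf).symm
        (MulAut.conjNormal (g b) (MonoidHom.ofInjective hf a)) := rfl
    rw [h1, MonoidHom.apply_ofInjective_symm, MulAut.conjNormal_apply,
      MonoidHom.ofInjective_apply]
  let F : N ⋊[φ] K →* G := SemidirectProduct.lift f g fun b => by
    ext a
    simp [hφ]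
  have hF : ∀ x, F x = f x.left * g x.right := fun _ => rfl
  refine ⟨φ, MulEquiv.ofBijective F ⟨?_, ?_⟩, ?_, ?_⟩
  · rw [injective_iff_map_eq_one]
    intro x hx
    rw [hF] at hx
    have h1 : f x.left = g x.right⁻¹ := by rw [map_inv]; exact eq_inv_of_mul_eq_one_left hx
    have h2 := hdisj _ _ h1
    rw [h2, one_mul] at hx
    exact SemidirectProduct.ext ((map_eq_one_iff f hf).mp h2) ((map_eq_one_iff g hg).mp hx)
  · intro x
    obtain ⟨a, b, h⟩ := hsurj x
    exact ⟨⟨a, b⟩, h⟩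
  · intro a
    change F _ = _
    rw [hF, SemidirectProduct.left_inl, SemidirectProduct.right_inl, map_one, mul_one]
  · intro b
    change F _ = _
    rw [hF, SemidirectProduct.left_inr, SemidirectProduct.right_inr, map_one, one_mul]

/-! ### Codes between `C^(u)` and the Hamming code -/

section Field

variable {F : Type*} [Field F] {u : ℕ} {α : F}

/-- The field element attached to a coordinate of the extended codes. -/
def coordElt (u : ℕ) (α : F) : Fin (2 ^ (2 * u) - 1 + 1) → F :=
  Fin.cons 0 fun j => α ^ (j : ℕ)

@[simp]
theorem coordElt_zero : coordElt u α 0 = 0 := rfl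

@[simp]
theorem coordElt_succ (j : Fin (2 ^ (2 * u) - 1)) : coordElt u α j.succ = α ^ (j : ℕ) := rfl

theorem coordElt_bijective [Fintype F] (hu : 1 ≤ u) (hF : Fintype.card F = 2 ^ (2 * u))
    (hα : IsPrimitiveRoot α (2 ^ (2 * u) - 1)) : Function.Bijective (coordElt u α) := by
  have h4 : 2 ^ 2 ≤ 2 ^ (2 * u) := Nat.pow_le_pow_right (by norm_num) (by omega)
  have hα0 : α ≠ 0 := hα.ne_zero (by omega)
  refine (Fintype.bijective_iff_injective_and_card _).mpr ⟨?_, ?_⟩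
  · intro j k h
    cases j using Fin.cases with
    | zero =>
      cases k using Fin.cases with
      | zero => rfl
      | succ k => exact absurd h.symm (pow_ne_zero _ hα0)
    | succ j =>
      cases k using Fin.cases with
      | zero => exact absurd h (pow_ne_zero _ hα0)
      | succ k => exact congrArg Fin.succ (Fin.ext (hα.pow_inj j.2 k.2 h))
  · rw [Fintype.card_fin, hF]
    omega

/-! ### Translations of the field as coordinate permutations -/

section Translations

variable [Fintype F] (hu : 1 ≤ u) (hF : Fintype.card F = 2 ^ (2 * u))
  (hα : IsPrimitiveRoot α (2 ^ (2 * u) - 1))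

/-- The identification of the extended coordinates with the elements of the field. -/
def coordEquiv : Fin (2 ^ (2 * u) - 1 + 1) ≃ F :=
  Equiv.ofBijective _ (coordElt_bijective hu hF hα)

/-- The permutation of the extended coordinates given by a translation of the field. -/
def translation : Multiplicative F →* Equiv.Perm (Fin (2 ^ (2 * u) - 1 + 1)) where
  toFun a := (coordEquiv hu hF hα).symm.permCongr (Equiv.addLeft a.toAdd)
  map_one' := by
    ext k
    simp
  map_mul' a b := by
    ext k
    simp

theorem coordElt_translation (a : Multiplicative F) (k : Fin (2 ^ (2 * u) - 1 + 1)) :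
    coordElt u α (translation hu hF hα a k) = a.toAdd + coordElt u α k :=
  (coordEquiv hu hF hα).apply_symm_apply _

end Translations

variable [Algebra (ZMod 2) F]

theorem coordVec_eq (rep : F ≃ₗ[ZMod 2] (Fin (2 * u) → ZMod 2))
    (k : Fin (2 ^ (2 * u) - 1 + 1)) : coordVec rep α k = rep (coordElt u α k) := by
  cases k using Fin.cases with
  | zero => simp [coordVec]
  | succ j => rfl

/-! ### Syndromes on the extended coordinates -/

variable (u α) in
/-- The linear part of the syndrome of a vector on the extended coordinates. -/
def linSyndrome : (Fin (2 ^ (2 * u) - 1 + 1) → ZMod 2) →ₗ[ZMod 2] F :=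
  Fintype.linearCombination (ZMod 2) (coordElt u α)

variable (u α) in
/-- The norm part of the syndrome of a vector on the extended coordinates. -/
def normSyndrome : (Fin (2 ^ (2 * u) - 1 + 1) → ZMod 2) →ₗ[ZMod 2] F :=
  Fintype.linearCombination (ZMod 2) fun k => coordElt u α k ^ (2 ^ u + 1)

theorem linSyndrome_apply (x : Fin (2 ^ (2 * u) - 1 + 1) → ZMod 2) :
    linSyndrome u α x = ∑ k, x k • coordElt u α k := rfl

theorem normSyndrome_apply (x : Fin (2 ^ (2 * u) - 1 + 1) → ZMod 2) :
    normSyndrome u α x = ∑ k, x k • coordElt u α k ^ (2 ^ u + 1) := rfl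

theorem linSyndrome_single (k : Fin (2 ^ (2 * u) - 1 + 1)) :
    linSyndrome u α (Pi.single k 1) = coordElt u α k := by
  simp [linSyndrome]

theorem normSyndrome_single (k : Fin (2 ^ (2 * u) - 1 + 1)) :
    normSyndrome u α (Pi.single k 1) = coordElt u α k ^ (2 ^ u + 1) := by
  simp [normSyndrome]

theorem linSyndrome_succ (x : Fin (2 ^ (2 * u) - 1 + 1) → ZMod 2) :
    linSyndrome u α x = ∑ j, x (Fin.succ j) • α ^ (j : ℕ) := by
  simp [linSyndrome_apply, Fin.sum_univ_succ]

theorem normSyndrome_succ (x : Fin (2 ^ (2 * u) - 1 + 1) → ZMod 2) :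
    normSyndrome u α x = ∑ j, x (Fin.succ j) • α ^ ((j : ℕ) * (2 ^ u + 1)) := by
  simp [normSyndrome_apply, Fin.sum_univ_succ, pow_mul]

theorem linSyndrome_permVec (π : Equiv.Perm (Fin (2 ^ (2 * u) - 1 + 1)))
    (x : Fin (2 ^ (2 * u) - 1 + 1) → ZMod 2) :
    linSyndrome u α (permVec π x) = ∑ k, x k • coordElt u α (π k) := by
  rw [linSyndrome_apply, ← Equiv.sum_comp π]
  simp only [permVec_apply_apply]

theorem normSyndrome_permVec (π : Equiv.Perm (Fin (2 ^ (2 * u) - 1 + 1)))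
    (x : Fin (2 ^ (2 * u) - 1 + 1) → ZMod 2) :
    normSyndrome u α (permVec π x) = ∑ k, x k • coordElt u α (π k) ^ (2 ^ u + 1) := by
  rw [normSyndrome_apply, ← Equiv.sum_comp π]
  simp only [permVec_apply_apply]

theorem permVec_single {ι : Type*} [DecidableEq ι] (σ : Equiv.Perm ι) (k : ι) :
    permVec σ (Pi.single k 1) = Pi.single (σ k) 1 := by
  funext j
  obtain ⟨l, rfl⟩ := σ.surjective j
  simp [permVec_apply_apply, Pi.single_apply]

theorem mem_codeU {rep : F ≃ₗ[ZMod 2] (Fin (2 * u) → ZMod 2)}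
    {c : Fin (2 ^ (2 * u) - 1) → ZMod 2} :
    c ∈ codeU rep α ↔
      ∑ j, c j • α ^ (j : ℕ) = 0 ∧ ∑ j, c j • α ^ ((j : ℕ) * (2 ^ u + 1)) = 0 := by
  have hH : Matrix.mulVec (matrixH rep α) c = rep (∑ j, c j • α ^ (j : ℕ)) := by
    funext k
    simp [Matrix.mulVec, dotProduct, matrixH, Finset.sum_apply, mul_comm]
  have hE : Matrix.mulVec (matrixE rep α) c = rep (∑ j, c j • α ^ ((j : ℕ) * (2 ^ u + 1))) := by
    funext k
    simp [Matrix.mulVec, dotProduct, matrixE, Finset.sum_apply, mul_comm]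
  rw [codeU, LinearMap.mem_ker, Matrix.mulVecLin_apply, Matrix.fromRows_mulVec, hH, hE]
  constructor
  · intro h
    refine ⟨rep.map_eq_zero_iff.mp (funext fun k => ?_),
      rep.map_eq_zero_iff.mp (funext fun k => ?_)⟩
    · exact congrFun h (Sum.inl k)
    · exact congrFun h (Sum.inr k)
  · rintro ⟨h1, h2⟩
    rw [h1, h2, map_zero]
    exact Sum.elim_zero_zero

theorem mem_extendedCode_codeU {rep : F ≃ₗ[ZMod 2] (Fin (2 * u) → ZMod 2)}
    {x : Fin (2 ^ (2 * u) - 1 + 1) → ZMod 2} :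
    x ∈ extendedCode (codeU rep α) ↔
      linSyndrome u α x = 0 ∧ normSyndrome u α x = 0 ∧ ∑ k, x k = 0 := by
  rw [mem_extendedCode, mem_codeU, linSyndrome_succ, normSyndrome_succ, and_assoc]

theorem charP_two_of_algebra : CharP F 2 :=
  charP_of_injective_algebraMap (algebraMap (ZMod 2) F).injective 2

/-- Norms lie in the subfield fixed by y ↦ y^q, and so do their sums with binary coefficients. -/
theorem normSyndrome_pow [Fintype F] (hF : Fintype.card F = 2 ^ (2 * u))
    (x : Fin (2 ^ (2 * u) - 1 + 1) → ZMod 2) :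
    normSyndrome u α x ^ 2 ^ u = normSyndrome u α x := by
  have := charP_two_of_algebra (F := F)
  have hq2 : ∀ y : F, (y ^ 2 ^ u) ^ 2 ^ u = y := by
    intro y
    rw [← pow_mul, ← pow_add, ← two_mul, ← hF]
    exact FiniteField.pow_card y
  have h2 : ∀ a : ZMod 2, a = 0 ∨ a = 1 := by decide
  rw [normSyndrome_apply, sum_pow_char_pow]
  refine Finset.sum_congr rfl fun k _ => ?_
  have h3 : ∀ y : F, (y ^ (2 ^ u + 1)) ^ 2 ^ u = y ^ (2 ^ u + 1) := by
    intro y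
    rw [pow_succ, mul_pow, hq2, mul_comm]
  rcases h2 (x k) with h | h
  · simp [h]
  · simp [h, h3]

/-- Every pair `(h, e)` with `h ≠ 0` and `e` in the subfield is the syndrome of a vector of
weight two. -/
theorem exists_norm_add_norm [Fintype F] (hu : 1 ≤ u) (hF : Fintype.card F = 2 ^ (2 * u))
    (hα : IsPrimitiveRoot α (2 ^ (2 * u) - 1)) {h e : F} (hh : h ≠ 0) (he : e ^ 2 ^ u = e) :
    ∃ a : F, a ^ (2 ^ u + 1) + (a + h) ^ (2 ^ u + 1) = e := by
  have hch := charP_two_of_algebra (F := F)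
  have hq2 : ∀ y : F, (y ^ 2 ^ u) ^ 2 ^ u = y := by
    intro y
    rw [← pow_mul, ← pow_add, ← two_mul, ← hF]
    exact FiniteField.pow_card y
  have hadd : ∀ y z : F, (y + z) ^ 2 ^ u = y ^ 2 ^ u + z ^ 2 ^ u := fun y z =>
    add_pow_char_pow (p := 2) (n := u) y z
  have hself : ∀ y : F, y + y = 0 := fun y => CharTwo.add_self_eq_zero y
  have h2 : 2 ≤ 2 ^ u := by
    calc 2 = 2 ^ 1 := rfl
      _ ≤ 2 ^ u := Nat.pow_le_pow_right (by norm_num) hu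
  have hsq : 2 ^ (2 * u) = 2 ^ u * 2 ^ u := by rw [two_mul, pow_add]
  have hlt : 2 ^ u < 2 ^ (2 * u) := by rw [hsq]; nlinarith
  have hα0 : α ≠ 0 := hα.ne_zero (by omega)
  have hT : α ^ 2 ^ u + α ≠ 0 := by
    intro h
    have h1 : α ^ 2 ^ u = α := CharTwo.add_eq_zero.mp h
    have h3 : α ^ (2 ^ u - 1) = 1 := by
      have h4 : α * α ^ (2 ^ u - 1) = α * 1 := by
        rw [← pow_succ', Nat.sub_add_cancel (by omega), h1, mul_one]
      exact mul_left_cancel₀ hα0 h4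
    exact hα.pow_ne_one_of_pos_of_lt (by omega) (by omega) h3
  have hhq : h ^ 2 ^ u ≠ 0 := pow_ne_zero _ hh
  -- Expanding the norms turns the equation into Tr(a h^q) = e + N(h), where Tr(y) = y^q + y. As `T`
  -- is the trace of `α`, nonzero by `hT`, the choice a h^q = α e' / T solves it.
  set T := α ^ 2 ^ u + α with hTdef
  have hTq : T ^ 2 ^ u = T := by rw [hTdef, hadd, hq2, add_comm]
  set e' := e + h ^ 2 ^ u * h with he'
  have heq : e' ^ 2 ^ u = e' := by rw [he', hadd, mul_pow, hq2, he, mul_comm h]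
  refine ⟨α * e' / (T * h ^ 2 ^ u), ?_⟩
  set a := α * e' / (T * h ^ 2 ^ u) with ha
  have h5 : a * h ^ 2 ^ u = α * e' / T := by rw [ha]; field_simp
  have h6 : a ^ 2 ^ u * h = α ^ 2 ^ u * e' / T := by
    rw [ha, div_pow, mul_pow, mul_pow, hq2, hTq, heq]; field_simp
  have h7 : a * h ^ 2 ^ u + a ^ 2 ^ u * h = e' := by
    rw [h5, h6, ← add_div, ← add_mul, add_comm α, ← hTdef, mul_div_cancel_left₀ _ hT]
  rw [pow_succ, pow_succ, hadd]
  linear_combination h7 + he' + hself (a ^ 2 ^ u * a) + hself (h ^ 2 ^ u * h)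

/-- The pair of positions labelled s and s + h, with h the linear syndrome of `x`, can be chosen
with the same norm syndrome as `x`; h ≠ 0 keeps the positions distinct. -/
theorem exists_add_single_mem [Fintype F] (hu : 1 ≤ u) (hF : Fintype.card F = 2 ^ (2 * u))
    (hα : IsPrimitiveRoot α (2 ^ (2 * u) - 1)) (rep : F ≃ₗ[ZMod 2] (Fin (2 * u) → ZMod 2))
    {x : Fin (2 ^ (2 * u) - 1 + 1) → ZMod 2} (hx : ∑ k, x k = 0)
    (hlin : linSyndrome u α x ≠ 0) :
    ∃ a b, a ≠ b ∧ x + (Pi.single a 1 + Pi.single b 1) ∈ extendedCode (codeU rep α) := by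
  have := charP_two_of_algebra (F := F)
  obtain ⟨s, hs⟩ := exists_norm_add_norm hu hF hα hlin (normSyndrome_pow hF x)
  obtain ⟨a, ha⟩ := (coordElt_bijective hu hF hα).2 s
  obtain ⟨b, hb⟩ := (coordElt_bijective hu hF hα).2 (s + linSyndrome u α x)
  refine ⟨a, b, ?_, mem_extendedCode_codeU.mpr ⟨?_, ?_, ?_⟩⟩
  · rintro rfl
    rw [ha] at hb
    exact hlin (left_eq_add.mp hb)
  · rw [map_add, map_add, linSyndrome_single, linSyndrome_single, ha, hb, ← add_assoc s,
      CharTwo.add_self_eq_zero, zero_add, CharTwo.add_self_eq_zero]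
  · rw [map_add, map_add, normSyndrome_single, normSyndrome_single, ha, hb, hs,
      CharTwo.add_self_eq_zero]
  · simp [Finset.sum_add_distrib, hx, CharTwo.add_self_eq_zero]

/-- Cosets of `C^(u)` of weight at least three are contained in the Hamming code. -/
theorem sum_smul_eq_zero_of_cosetWeight [Fintype F] (hu : 1 ≤ u)
    (hF : Fintype.card F = 2 ^ (2 * u)) (hα : IsPrimitiveRoot α (2 ^ (2 * u) - 1))
    (rep : F ≃ₗ[ZMod 2] (Fin (2 * u) → ZMod 2)) {c : Fin (2 ^ (2 * u) - 1) → ZMod 2}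
    (hc : 3 ≤ cosetWeight (codeU rep α) c) : ∑ j, c j • α ^ (j : ℕ) = 0 := by
  by_contra hne
  have hsum : ∑ k, extendVec c k = 0 := by
    simp [Fin.sum_univ_succ, extendVec, CharTwo.add_self_eq_zero]
  have hlin : linSyndrome u α (extendVec c) ≠ 0 := by
    rwa [linSyndrome_succ]
  obtain ⟨a, b, -, hab⟩ := exists_add_single_mem hu hF hα rep hsum hlin
  set z : Fin (2 ^ (2 * u) - 1 + 1) → ZMod 2 := Pi.single a 1 + Pi.single b 1 with hz
  have hz2 : hammingNorm z ≤ 2 := by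
    refine (Finset.card_le_card (t := {a, b}) fun k hk => ?_).trans Finset.card_le_two
    by_contra hkab
    simp only [Finset.mem_insert, Finset.mem_singleton, not_or] at hkab
    simp [hz, hkab.1, hkab.2] at hk
  -- The punctured `z` lies in the coset of `c`, so that coset would have weight at most two.
  have hmem : cosetWeight (codeU rep α) c ≤ hammingNorm fun j => z (Fin.succ j) := by
    refine Nat.sInf_le ⟨_, hab.1, ?_⟩
    congr 1
    funext j
    have h : ∀ s t : ZMod 2, s + t + s = t := by decide
    exact h _ _
  have h3 := hammingNorm_succ z
  omega

/-- Permutations preserving an extended code between `C^(u)` and the Hamming code preserve the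
extended Hamming code. -/
theorem linSyndrome_permVec_eq_zero [Fintype F] (hu : 1 ≤ u)
    (hF : Fintype.card F = 2 ^ (2 * u)) (hα : IsPrimitiveRoot α (2 ^ (2 * u) - 1))
    {rep : F ≃ₗ[ZMod 2] (Fin (2 * u) → ZMod 2)}
    {C : Submodule (ZMod 2) (Fin (2 ^ (2 * u) - 1) → ZMod 2)} (hle : codeU rep α ≤ C)
    (hC : ∀ c ∈ C, ∑ j, c j • α ^ (j : ℕ) = 0)
    {π : Equiv.Perm (Fin (2 ^ (2 * u) - 1 + 1))} (hπ : π ∈ autGroup (extendedCode C))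
    {x : Fin (2 ^ (2 * u) - 1 + 1) → ZMod 2} (hx : ∑ k, x k = 0)
    (hlin : linSyndrome u α x = 0) : linSyndrome u α (permVec π x) = 0 := by
  have := charP_two_of_algebra (F := F)
  by_contra hne
  obtain ⟨a, b, hab, hmem⟩ := exists_add_single_mem hu hF hα rep
    (x := permVec π x) (by rw [sum_permVec, hx]) hne
  -- Pulled back by `π`, the word becomes `x` plus a word of weight two. The Hamming condition then
  -- forces the two positions to have equal labels.
  have h1 := inv_mem hπ _ (show _ ∈ extendedCode C from ⟨hle hmem.1, hmem.2⟩)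
  have h2 := hC _ h1.1
  rw [← linSyndrome_succ (α := α), map_add, map_add (permVec π⁻¹), permVec_single, permVec_single,
    ← permVec_mul, inv_mul_cancel, permVec_one, map_add, map_add, hlin, zero_add,
    linSyndrome_single, linSyndrome_single, CharTwo.add_eq_zero] at h2
  exact hab ((π⁻¹).injective ((coordElt_bijective hu hF hα).1 h2))

/-- Automorphisms are affine: the word supported on `l`, `j`, `k` and 0 (counted modulo 2) lies in
the extended Hamming code, which `π` preserves. -/
theorem coordElt_perm_add [Fintype F] (hu : 1 ≤ u)
    (hF : Fintype.card F = 2 ^ (2 * u)) (hα : IsPrimitiveRoot α (2 ^ (2 * u) - 1))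
    {rep : F ≃ₗ[ZMod 2] (Fin (2 * u) → ZMod 2)}
    {C : Submodule (ZMod 2) (Fin (2 ^ (2 * u) - 1) → ZMod 2)} (hle : codeU rep α ≤ C)
    (hC : ∀ c ∈ C, ∑ j, c j • α ^ (j : ℕ) = 0)
    {π : Equiv.Perm (Fin (2 ^ (2 * u) - 1 + 1))} (hπ : π ∈ autGroup (extendedCode C))
    {j k l : Fin (2 ^ (2 * u) - 1 + 1)} (h : coordElt u α l = coordElt u α j + coordElt u α k) :
    coordElt u α (π l) = coordElt u α (π j) + coordElt u α (π k) + coordElt u α (π 0) := by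
  have := charP_two_of_algebra (F := F)
  have h1 := linSyndrome_permVec_eq_zero hu hF hα hle hC hπ
    (x := Pi.single l 1 + (Pi.single j 1 + Pi.single k 1 + Pi.single 0 1))
    (by simp [Finset.sum_add_distrib]; decide)
    (by simp [linSyndrome_single, h, CharTwo.add_self_eq_zero])
  simp only [map_add, permVec_single, linSyndrome_single] at h1
  exact CharTwo.add_eq_zero.mp h1

/-! ### Translations as a normal subgroup of the automorphism group -/

section TranslationAut

variable [Fintype F] (hu : 1 ≤ u) (hF : Fintype.card F = 2 ^ (2 * u))
  (hα : IsPrimitiveRoot α (2 ^ (2 * u) - 1))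

theorem translation_mem_autGroup {rep : F ≃ₗ[ZMod 2] (Fin (2 * u) → ZMod 2)}
    {C : Submodule (ZMod 2) (Fin (2 ^ (2 * u) - 1) → ZMod 2)} (hle : codeU rep α ≤ C)
    (hC : ∀ c ∈ C, ∑ j, c j • α ^ (j : ℕ) = 0) (a : Multiplicative F) :
    translation hu hF hα a ∈ autGroup (extendedCode C) := by
  have := charP_two_of_algebra (F := F)
  intro x hx
  have hlin : linSyndrome u α x = 0 := by
    rw [linSyndrome_succ]
    exact hC _ hx.1
  have hsum : ∀ s : F, ∑ k, x k • s = 0 := by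
    intro s
    rw [← Finset.sum_smul, hx.2, zero_smul]
  -- The change lies in the smallest code of the sandwich, so every `C` in between is invariant.
  have hdiff : permVec (translation hu hF hα a) x - x ∈ extendedCode (codeU rep α) := by
    rw [mem_extendedCode_codeU, map_sub, map_sub]
    refine ⟨?_, ?_, ?_⟩
    · rw [linSyndrome_permVec, hlin]
      simp only [coordElt_translation, smul_add, Finset.sum_add_distrib, hsum]
      rw [← linSyndrome_apply, hlin, add_zero, sub_zero]
    -- The q-th power of the linear syndrome; it kills the term s y^q in the expansion of N(s + y).
    · have hlinq : ∑ k, x k • coordElt u α k ^ 2 ^ u = 0 := by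
        have h2 : ∀ a : ZMod 2, a = 0 ∨ a = 1 := by decide
        have h : linSyndrome u α x ^ 2 ^ u = 0 := by simp [hlin]
        rw [linSyndrome_apply, sum_pow_char_pow] at h
        rw [← h]
        refine Finset.sum_congr rfl fun k _ => ?_
        rcases h2 (x k) with h | h <;> simp [h]
      set s := a.toAdd
      have hexp : ∀ y : F, (s + y) ^ (2 ^ u + 1) =
          s ^ (2 ^ u + 1) + s ^ 2 ^ u * y + s * y ^ 2 ^ u + y ^ (2 ^ u + 1) := by
        intro y
        rw [pow_succ, add_pow_char_pow]
        ring
      rw [normSyndrome_permVec]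
      simp only [coordElt_translation]
      change ∑ k, x k • (s + coordElt u α k) ^ (2 ^ u + 1) - _ = 0
      simp only [hexp, smul_add, Finset.sum_add_distrib, hsum, ← mul_smul_comm, ← Finset.mul_sum,
        hlinq]
      rw [← linSyndrome_apply, hlin, ← normSyndrome_apply]
      simp
    · simp only [Pi.sub_apply, Finset.sum_sub_distrib, sum_permVec, sub_self]
  have h := add_mem (show _ ∈ extendedCode C from ⟨hle hdiff.1, hdiff.2⟩) hx
  rwa [sub_add_cancel] at h

/-- The translations, as automorphisms of the extended code. -/
def translationAut {rep : F ≃ₗ[ZMod 2] (Fin (2 * u) → ZMod 2)}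
    {C : Submodule (ZMod 2) (Fin (2 ^ (2 * u) - 1) → ZMod 2)} (hle : codeU rep α ≤ C)
    (hC : ∀ c ∈ C, ∑ j, c j • α ^ (j : ℕ) = 0) :
    Multiplicative (Fin (2 * u) → ZMod 2) →* autGroup (extendedCode C) :=
  ((translation hu hF hα).codRestrict _ (translation_mem_autGroup hu hF hα hle hC)).comp
    rep.symm.toLinearMap.toAddMonoidHom.toMultiplicative

theorem coordElt_translationAut {rep : F ≃ₗ[ZMod 2] (Fin (2 * u) → ZMod 2)}
    {C : Submodule (ZMod 2) (Fin (2 ^ (2 * u) - 1) → ZMod 2)} (hle : codeU rep α ≤ C)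
    (hC : ∀ c ∈ C, ∑ j, c j • α ^ (j : ℕ) = 0) (w : Multiplicative (Fin (2 * u) → ZMod 2))
    (k : Fin (2 ^ (2 * u) - 1 + 1)) :
    coordElt u α ((translationAut hu hF hα hle hC w : Equiv.Perm _) k) =
      rep.symm w.toAdd + coordElt u α k :=
  coordElt_translation hu hF hα _ k

/-- The automorphism group of the extended code is the semidirect product of the translations and
the automorphism group of the code. -/
theorem exists_semidirectProduct_extendedCode {rep : F ≃ₗ[ZMod 2] (Fin (2 * u) → ZMod 2)}
    {C : Submodule (ZMod 2) (Fin (2 ^ (2 * u) - 1) → ZMod 2)} (hle : codeU rep α ≤ C)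
    (hC : ∀ c ∈ C, ∑ j, c j • α ^ (j : ℕ) = 0) :
    ∃ (φ : autGroup C →* MulAut (Multiplicative (Fin (2 * u) → ZMod 2)))
      (e : Multiplicative (Fin (2 * u) → ZMod 2) ⋊[φ] autGroup C ≃* autGroup (extendedCode C)),
      (∀ w, e (SemidirectProduct.inl w) = translationAut hu hF hα hle hC w) ∧
        ∀ σ, e (SemidirectProduct.inr σ) = extendAut C σ := by
  have := charP_two_of_algebra (F := F)
  have hinj := (coordElt_bijective hu hF hα).1
  have hext : ∀ π τ : autGroup (extendedCode C),
      (∀ k, coordElt u α ((π : Equiv.Perm _) k) = coordElt u α ((τ : Equiv.Perm _) k)) →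
        π = τ := fun π τ h => Subtype.ext (Equiv.ext fun k => hinj (h k))
  refine exists_semidirectProduct_mulEquiv _ _ ?_ ?_ ⟨?_⟩ ?_ ?_
  · intro w w' h
    have h1 := coordElt_translationAut hu hF hα hle hC w 0
    rw [h, coordElt_translationAut] at h1
    exact (rep.symm.injective (add_right_cancel h1)).symm
  · intro σ τ h
    refine Subtype.ext (Equiv.ext fun j => ?_)
    have h1 := congrArg (fun π : autGroup (extendedCode C) => (π : Equiv.Perm _) j.succ) h
    simpa [coe_extendAut] using h1
  · rintro _ ⟨w, rfl⟩ π
    set τ := translationAut hu hF hα hle hC w with hτ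
    -- Since `π` is affine, conjugating by it gives the translation by π(0) + π(τ(0)), signs being
    -- irrelevant in characteristic two.
    refine ⟨Multiplicative.ofAdd (rep (coordElt u α ((π : Equiv.Perm _) 0) +
      coordElt u α ((π : Equiv.Perm _) ((τ : Equiv.Perm _) 0)))), hext _ _ fun k => ?_⟩
    obtain ⟨l, rfl⟩ := (π : Equiv.Perm _).surjective k
    have h1 : coordElt u α ((τ : Equiv.Perm _) l) =
        coordElt u α l + coordElt u α ((τ : Equiv.Perm _) 0) := by
      rw [hτ, coordElt_translationAut, coordElt_translationAut, coordElt_zero, add_zero, add_comm]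
    have h2 := coordElt_perm_add hu hF hα hle hC π.2 h1
    rw [coordElt_translationAut]
    have h3 : ((π * τ * π⁻¹ : autGroup (extendedCode C)) : Equiv.Perm _)
        ((π : Equiv.Perm _) l) = (π : Equiv.Perm _) ((τ : Equiv.Perm _) l) := by
      simp
    rw [h3, h2, toAdd_ofAdd, LinearEquiv.symm_apply_apply]
    ring
  -- A translation that fixes the parity coordinate is the identity.
  · intro w σ h
    refine hext _ _ fun k => ?_
    have h1 := coordElt_translationAut hu hF hα hle hC w 0
    rw [h, coe_extendAut, extendPerm_zero, coordElt_zero, add_zero] at h1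
    rw [coordElt_translationAut, ← h1, zero_add]
    rfl
  · intro π
    -- Undoing the translation by the label of π(0) leaves an automorphism fixing the parity
    -- coordinate.
    set w : Multiplicative (Fin (2 * u) → ZMod 2) :=
      Multiplicative.ofAdd (rep (coordElt u α ((π : Equiv.Perm _) 0))) with hw
    set ρ := (translationAut hu hF hα hle hC w)⁻¹ * π with hρ
    have hρ0 : (ρ : Equiv.Perm (Fin (2 ^ (2 * u) - 1 + 1))) 0 = 0 := by
      rw [hρ, Subgroup.coe_mul, Subgroup.coe_inv, Equiv.Perm.mul_apply, Equiv.Perm.inv_eq_iff_eq]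
      refine hinj ?_
      rw [coordElt_translationAut, hw, coordElt_zero, add_zero]
      simp
    obtain ⟨σ, hσ⟩ := exists_extendPerm_eq hρ0
    refine ⟨w, ⟨σ, extendPerm_mem_autGroup.mp (hσ ▸ ρ.2)⟩, ?_⟩
    have h1 : extendAut C ⟨σ, extendPerm_mem_autGroup.mp (hσ ▸ ρ.2)⟩ = ρ := Subtype.ext hσ
    rw [h1, hρ, mul_inv_cancel_left]

end TranslationAut

/-- Every coordinate of the extended code can be moved to the parity coordinate. -/
theorem exists_autGroup_apply_eq_zero [Fintype F] (hu : 1 ≤ u)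
    (hF : Fintype.card F = 2 ^ (2 * u)) (hα : IsPrimitiveRoot α (2 ^ (2 * u) - 1))
    {rep : F ≃ₗ[ZMod 2] (Fin (2 * u) → ZMod 2)}
    {C : Submodule (ZMod 2) (Fin (2 ^ (2 * u) - 1) → ZMod 2)} (hle : codeU rep α ≤ C)
    (hC : ∀ c ∈ C, ∑ j, c j • α ^ (j : ℕ) = 0) (k : Fin (2 ^ (2 * u) - 1 + 1)) :
    ∃ π ∈ autGroup (extendedCode C), π k = 0 := by
  refine ⟨_, translation_mem_autGroup hu hF hα hle hC (Multiplicative.ofAdd (-coordElt u α k)),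
    (coordElt_bijective hu hF hα).1 ?_⟩
  rw [coordElt_translation]
  simp

/-- The upper half of the sandwich: the weight-three condition puts each generator `v l` in the
Hamming code. -/
theorem sum_smul_eq_zero_of_mem_nestedCode [Fintype F] (hu : 1 ≤ u)
    (hF : Fintype.card F = 2 ^ (2 * u)) (hα : IsPrimitiveRoot α (2 ^ (2 * u) - 1))
    {rep : F ≃ₗ[ZMod 2] (Fin (2 * u) → ZMod 2)} {k : ℕ}
    {v : Fin k → Fin (2 ^ (2 * u) - 1) → ZMod 2} (hv : Admissible rep α v) :
    ∀ c ∈ nestedCode rep α v, ∑ j, c j • α ^ (j : ℕ) = 0 := by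
  have hle : nestedCode rep α v ≤ LinearMap.ker
      (Fintype.linearCombination (ZMod 2) fun j : Fin (2 ^ (2 * u) - 1) => α ^ (j : ℕ)) := by
    refine sup_le (fun c hc => (mem_codeU.mp hc).1) (Submodule.span_le.mpr ?_)
    rintro _ ⟨l, rfl⟩
    exact sum_smul_eq_zero_of_cosetWeight hu hF hα rep (hv.1 l).ge
  exact fun c hc => hle hc

end Field

end NestedCodes

end

theorem mainTheorem5 {F : Type*} [Field F] [Fintype F] [Algebra (ZMod 2) F]
    (u : ℕ) (hu : 1 ≤ u) (hF : Fintype.card F = 2 ^ (2 * u))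
    (α : F) (hα : IsPrimitiveRoot α (2 ^ (2 * u) - 1))
    (rep : F ≃ₗ[ZMod 2] (Fin (2 * u) → ZMod 2))
    (i : ℕ) (hi : i ≤ u)
    (v : Fin (u - i) → Fin (2 ^ (2 * u) - 1) → ZMod 2)
    (hv : NestedCodes.Admissible rep α v) :
    (∃ (φ : NestedCodes.autGroup (NestedCodes.nestedCode rep α v) →*
          MulAut (Multiplicative (Fin (2 * u) → ZMod 2)))
        (e : Multiplicative (Fin (2 * u) → ZMod 2) ⋊[φ]
            NestedCodes.autGroup (NestedCodes.nestedCode rep α v) ≃*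
          NestedCodes.autGroup
            (NestedCodes.extendedCode (NestedCodes.nestedCode rep α v))),
        (∀ (w : Fin (2 * u) → ZMod 2) (j : Fin (2 ^ (2 * u) - 1 + 1)),
          NestedCodes.coordVec rep α
              ((e (SemidirectProduct.inl (Multiplicative.ofAdd w)) : Equiv.Perm _) j) =
            w + NestedCodes.coordVec rep α j) ∧
        (∀ σ : NestedCodes.autGroup (NestedCodes.nestedCode rep α v),
          (e (SemidirectProduct.inr σ) : Equiv.Perm (Fin (2 ^ (2 * u) - 1 + 1))) 0 = 0 ∧
          ∀ j : Fin (2 ^ (2 * u) - 1),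
            (e (SemidirectProduct.inr σ) : Equiv.Perm (Fin (2 ^ (2 * u) - 1 + 1))) j.succ =
              ((σ : Equiv.Perm (Fin (2 ^ (2 * u) - 1))) j).succ)) ∧
      (NestedCodes.CompletelyTransitive (NestedCodes.nestedCode rep α v) →
        NestedCodes.CompletelyTransitive
          (NestedCodes.extendedCode (NestedCodes.nestedCode rep α v))) := by
  have hle : NestedCodes.codeU rep α ≤ NestedCodes.nestedCode rep α v := le_sup_left
  have hC := NestedCodes.sum_smul_eq_zero_of_mem_nestedCode hu hF hα hv
  refine ⟨?_, NestedCodes.completelyTransitive_extendedCode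
    (NestedCodes.exists_autGroup_apply_eq_zero hu hF hα hle hC)⟩
  obtain ⟨φ, e, hinl, hinr⟩ :=
    NestedCodes.exists_semidirectProduct_extendedCode hu hF hα hle hC
  refine ⟨φ, e, fun w j => ?_, fun σ => ⟨?_, fun j => ?_⟩⟩
  · rw [hinl, NestedCodes.coordVec_eq, NestedCodes.coordVec_eq,
      NestedCodes.coordElt_translationAut, map_add]
    simp
  · rw [hinr, NestedCodes.coe_extendAut, NestedCodes.extendPerm_zero]
  · rw [hinr, NestedCodes.coe_extendAut, NestedCodes.extendPerm_succ]
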